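/- Let $C$ be a commutative ring with unit in which $2$ is invertible. For an associative $C$-algebra $R$, let $T(R)$ be the set of all polynomials $f$ in the free associative $C$-algebra $C\langle X\rangle$ on a countably infinite alphabet $X$ such that $f$ vanishes under every substitution of elements of $R$ for the variables. Here $C\langle X\rangle$ is the free algebra without unit (polynomials without constant term) when $R$ is not assumed to be unital; for unital $R$ one may take the free unital algebra as well. Let $S$ be the free supercommutative algebra over $C$: the unital $\mathbb Z/2$-graded algebra generated by even elements $y_1,y_2,\dots$ and odd elements $z_1,z_2,\dots$, subject only to the relations $\{x,x'\}=0$ for all $x,x'\in S$, where $$\{x,x'\}=[x_0,x'_0]+[x_1,x'_0]+[x_0,x'_1]+(x_1x'_1+x'_1x_1)$$ for the decompositions $x=x_0+x_1$, $x'=x'_0+x'_1$ into even and odd parts. Let $C[\varepsilon]=C[\theta,\varepsilon_1,\varepsilon_2,\dots]$ be the commutative $C$-algebra defined by the relations $\theta^2=2$ and $\varepsilon_i^2=\theta\varepsilon_i$ for all $i$, and let $\mathfrak G$ be the generalized Grassmann algebra over $C$: the unital $C[\varepsilon]$-algebra (with $C[\varepsilon]$ central) generated by $e_1,e_2,\dots$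 subject to the relations $[e_i,e_j]=\varepsilon_i\varepsilon_j e_ie_j$ for all $i,j$ (including $i=j$). Then for every associative, not necessarily unital, $C$-algebra $A$, $$T(A\otimes_C S)=T(A\otimes_C\mathfrak G)$$ in the free algebra without unit; for unital $A$ the same equality also holds in the free unital algebra. In particular, $T(M_n(S))=T(M_n(\mathfrak G))$ for every $n$, in the free unital algebra. -/

import Mathlib

universe u v

open scoped TensorProduct

noncomputable section

namespace GenGrassmann

/-! ### Polynomial identities -/

/-- The free associative algebra without unit on the countable alphabet `ℕ`: its basis consists of
the non-empty words. -/
abbrev FreeNonUnital (C : Type u) [CommRing C] : Type u :=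
  MonoidAlgebra C (FreeSemigroup ℕ)

/-- The value `f(a₀, a₁, …)` of a polynomial without constant term in an associative algebra that
need not have a unit. -/
def evalNonUnital {C : Type u} [CommRing C] {A : Type v} [NonUnitalRing A] [Module C A]
    [IsScalarTower C A A] [SMulCommClass C A A] (a : ℕ → A) (f : FreeNonUnital C) : A :=
  MonoidAlgebra.liftMagma C (FreeSemigroup.lift a) f

/-- The identities of a not necessarily unital associative algebra `A`, in the free associative
algebra without unit. -/
def idNonUnital (C : Type u) [CommRing C] (A : Type v) [NonUnitalRing A] [Module C A]
    [IsScalarTower C A A] [SMulCommClass C A A] : Set (FreeNonUnital C) :=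
  {f | ∀ a : ℕ → A, evalNonUnital a f = 0}

/-- The identities of a unital associative algebra `A`, in the free unital associative algebra
on the countable alphabet `ℕ`. -/
def idUnital (C : Type u) [CommRing C] (A : Type v) [Ring A] [Algebra C A] :
    Set (FreeAlgebra C ℕ) :=
  {f | ∀ a : ℕ → A, FreeAlgebra.lift C a f = 0}

/-! ### The free supercommutative algebra -/

/-- The generators of the free supercommutative algebra: even ones `y i` and odd ones `z i`. -/
inductive SuperGen : Type
  | y (i : ℕ)
  | z (i : ℕ)

/-- The parity of a generator. -/
def SuperGen.parity : SuperGen → ZMod 2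
  | .y _ => 0
  | .z _ => 1

/-- The free algebra on the generators `y i`, `z i`. -/
abbrev FreeSuper (C : Type u) [CommRing C] : Type u := FreeAlgebra C SuperGen

/-- The homogeneous component of parity `p` of the free superalgebra: the span of the words
whose letters have parities adding up to `p`. -/
def FreeSuper.component (C : Type u) [CommRing C] (p : ZMod 2) : Submodule C (FreeSuper C) :=
  Submodule.span C
    {x | ∃ w : List SuperGen, (w.map SuperGen.parity).sum = p ∧
      x = (w.map (FreeAlgebra.ι C)).prod}

/-- The relations `{x, x'} = 0` for all elements `x = x₀ + x₁` and `x' = x₀' + x₁'`, where `x₀, x₀'`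
are even, `x₁, x₁'` are odd, and
`{x, x'} = [x₀, x₀'] + [x₁, x₀'] + [x₀, x₁'] + (x₁ x₁' + x₁' x₁)`. -/
inductive SuperRel (C : Type u) [CommRing C] : FreeSuper C → FreeSuper C → Prop
  | supercomm (x₀ x₁ x₀' x₁' : FreeSuper C)
      (h₀ : x₀ ∈ FreeSuper.component C 0) (h₁ : x₁ ∈ FreeSuper.component C 1)
      (h₀' : x₀' ∈ FreeSuper.component C 0) (h₁' : x₁' ∈ FreeSuper.component C 1) :
      SuperRel C
        ((x₀ * x₀' - x₀' * x₀) + (x₁ * x₀' - x₀' * x₁) + (x₀ * x₁' - x₁' * x₀)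
          + (x₁ * x₁' + x₁' * x₁)) 0

/-- The free supercommutative algebra `S` over `C`. -/
def FreeSupercommutative (C : Type u) [CommRing C] : Type u := RingQuot (SuperRel C)

instance (C : Type u) [CommRing C] : Ring (FreeSupercommutative C) :=
  inferInstanceAs (Ring (RingQuot (SuperRel C)))

instance (C : Type u) [CommRing C] : Algebra C (FreeSupercommutative C) :=
  inferInstanceAs (Algebra C (RingQuot (SuperRel C)))

/-! ### The generalized Grassmann algebra -/

/-- The generators `θ` and `ε i` of the coefficient ring `C[ε]`. -/
inductive EpsGen : Type
  | theta
  | eps (i : ℕ)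

/-- The ideal generated by `θ ^ 2 - 2` and all `(ε i) ^ 2 - θ * ε i`. -/
def epsIdeal (C : Type u) [CommRing C] : Ideal (MvPolynomial EpsGen C) :=
  Ideal.span
    ({MvPolynomial.X EpsGen.theta ^ 2 - 2} ∪
      Set.range fun i : ℕ =>
        MvPolynomial.X (EpsGen.eps i) ^ 2
          - MvPolynomial.X EpsGen.theta * MvPolynomial.X (EpsGen.eps i))

/-- The commutative ring `C[ε] = C[θ, ε₀, ε₁, …]` with relations `θ ^ 2 = 2`, `ε i ^ 2 = θ * ε i`. -/
def EpsRing (C : Type u) [CommRing C] : Type u := MvPolynomial EpsGen C ⧸ epsIdeal C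

instance (C : Type u) [CommRing C] : CommRing (EpsRing C) :=
  inferInstanceAs (CommRing (MvPolynomial EpsGen C ⧸ epsIdeal C))

instance (C : Type u) [CommRing C] : Algebra C (EpsRing C) :=
  inferInstanceAs (Algebra C (MvPolynomial EpsGen C ⧸ epsIdeal C))

/-- The element `ε i` of `C[ε]`. -/
def EpsRing.eps (C : Type u) [CommRing C] (i : ℕ) : EpsRing C :=
  Ideal.Quotient.mk (epsIdeal C) (MvPolynomial.X (EpsGen.eps i))

/-- The relations `[e i, e j] = ε i * ε j * e i * e j`, for all `i` and `j`, in the free unital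
algebra over `C[ε]` on the `e i`. -/
inductive GrassmannRel (C : Type u) [CommRing C] :
    FreeAlgebra (EpsRing C) ℕ → FreeAlgebra (EpsRing C) ℕ → Prop
  | comm (i j : ℕ) :
      GrassmannRel C
        (FreeAlgebra.ι (EpsRing C) i * FreeAlgebra.ι (EpsRing C) j
          - FreeAlgebra.ι (EpsRing C) j * FreeAlgebra.ι (EpsRing C) i)
        ((EpsRing.eps C i * EpsRing.eps C j) •
          (FreeAlgebra.ι (EpsRing C) i * FreeAlgebra.ι (EpsRing C) j))

/-- The generalized Grassmann algebra `𝔊` over `C`; it is a `C[ε]`-algebra, hence a `C`-algebra. -/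
def GeneralizedGrassmann (C : Type u) [CommRing C] : Type u := RingQuot (GrassmannRel C)

instance (C : Type u) [CommRing C] : Ring (GeneralizedGrassmann C) :=
  inferInstanceAs (Ring (RingQuot (GrassmannRel C)))

instance (C : Type u) [CommRing C] : Algebra (EpsRing C) (GeneralizedGrassmann C) :=
  inferInstanceAs (Algebra (EpsRing C) (RingQuot (GrassmannRel C)))

instance (C : Type u) [CommRing C] : Algebra C (GeneralizedGrassmann C) :=
  inferInstanceAs (Algebra C (RingQuot (GrassmannRel C)))

instance (C : Type u) [CommRing C] : IsScalarTower C (EpsRing C) (GeneralizedGrassmann C) :=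
  inferInstanceAs (IsScalarTower C (EpsRing C) (RingQuot (GrassmannRel C)))

end GenGrassmann

end

/-!
The two algebras are related by two `C`-algebra homomorphisms. Since `2` is invertible, the elements
`η i = ½ θ ε i` of `C[ε]` are idempotents with `ε i ε j = 2 η i η j`, and the defining relations of
`𝔊` read `e j e i = (1 - 2 η i η j) e i e j`. Hence the elements `(1 - η i) e i` are central, while
the `η i e i` anticommute with each other and have square zero: `e i` is the sum of an even and of
an odd element.

* There is a surjection `S → 𝔊` (`exists_surjective_algHom`). It sends the `y i` to the
  `(1 - η i) e i` together with the central elements `θ` and `ε i`, and `z i` to `η i e i`. It stays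
  surjective after tensoring with `A`, so every identity of `A ⊗ S` is one of `A ⊗ 𝔊`.
* There is a homomorphism `S → 𝔊` with a `C`-linear left inverse (`exists_algHom_split`). After
  splitting the indices of the `e i` into two infinite halves, it sends `y i` to `(1 - η j) e j` with
  `j` in the first half, and `z i` to `η j e j` with `j` in the second. To invert it, specialize
  `η j` to `0` on the first half and to `1` on the second; this maps `𝔊` to `C[√2] ⊗ S`, and `C` is
  a direct summand of `C[√2]`. Because it is split, the homomorphism stays injective after tensoring
  with an arbitrary `A`, so every identity of `A ⊗ 𝔊` is one of `A ⊗ S`.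

Matrices over `S` and over `𝔊` are compared by applying the same two homomorphisms entrywise.
-/

noncomputable section

namespace GenGrassmann

universe w

variable {C : Type u} [CommRing C]

/-! ### Identities along homomorphisms -/

section Identities

variable {A B : Type*}

section NonUnital

variable [NonUnitalRing A] [Module C A] [IsScalarTower C A A] [SMulCommClass C A A]
  [NonUnitalRing B] [Module C B] [IsScalarTower C B B] [SMulCommClass C B B]

theorem map_evalNonUnital (g : A →ₙₐ[C] B) (a : ℕ → A) (f : FreeNonUnital C) :
    g (evalNonUnital a f) = evalNonUnital (fun i => g (a i)) f := by
  have h : g.comp (MonoidAlgebra.liftMagma C (FreeSemigroup.lift a)) =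
      MonoidAlgebra.liftMagma C (FreeSemigroup.lift fun i => g (a i)) := by
    apply MonoidAlgebra.nonUnitalAlgHom_ext'
    apply FreeSemigroup.hom_ext
    funext i
    simp
  exact DFunLike.congr_fun h f

theorem idNonUnital_subset_of_surjective (g : A →ₙₐ[C] B) (hg : Function.Surjective g) :
    idNonUnital C A ⊆ idNonUnital C B := by
  intro f hf b
  choose a ha using fun i => hg (b i)
  have h := map_evalNonUnital g a f
  rw [hf a, map_zero] at h
  simpa only [ha] using h.symm

theorem idNonUnital_subset_of_injective (g : A →ₙₐ[C] B) (hg : Function.Injective g) :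
    idNonUnital C B ⊆ idNonUnital C A := by
  intro f hf a
  apply hg
  rw [map_evalNonUnital, map_zero]
  exact hf _

end NonUnital

section Unital

variable [Ring A] [Algebra C A] [Ring B] [Algebra C B]

theorem map_freeAlgebra_lift (g : A →ₐ[C] B) (a : ℕ → A) (f : FreeAlgebra C ℕ) :
    g (FreeAlgebra.lift C a f) = FreeAlgebra.lift C (fun i => g (a i)) f := by
  have h : g.comp (FreeAlgebra.lift C a) = FreeAlgebra.lift C fun i => g (a i) := by
    ext i
    simp
  exact DFunLike.congr_fun h f

theorem idUnital_subset_of_surjective (g : A →ₐ[C] B) (hg : Function.Surjective g) :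
    idUnital C A ⊆ idUnital C B := by
  intro f hf b
  choose a ha using fun i => hg (b i)
  have h := map_freeAlgebra_lift g a f
  rw [hf a, map_zero] at h
  simpa only [ha] using h.symm

theorem idUnital_subset_of_injective (g : A →ₐ[C] B) (hg : Function.Injective g) :
    idUnital C B ⊆ idUnital C A := by
  intro f hf a
  apply hg
  rw [map_freeAlgebra_lift, map_zero]
  exact hf _

end Unital

/-- The homomorphism `A ⊗ S → A ⊗ T` induced by `g : S → T`, for an algebra `A` that need not have
a unit. -/
def lTensorNonUnital (A : Type v) [NonUnitalRing A] [Module C A] [IsScalarTower C A A]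
    [SMulCommClass C A A] {S T : Type*} [Ring S] [Algebra C S] [Ring T] [Algebra C T]
    (g : S →ₐ[C] T) : A ⊗[C] S →ₙₐ[C] A ⊗[C] T where
  __ := LinearMap.lTensor A g.toLinearMap
  map_zero' := map_zero (LinearMap.lTensor A g.toLinearMap)
  map_mul' x y := by
    change LinearMap.lTensor A g.toLinearMap (x * y) =
      LinearMap.lTensor A g.toLinearMap x * LinearMap.lTensor A g.toLinearMap y
    induction x with
    | zero => simp
    | add x₁ x₂ h₁ h₂ => simp only [add_mul, map_add, h₁, h₂]
    | tmul a s =>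
      induction y with
      | zero => simp
      | add y₁ y₂ h₁ h₂ => simp only [mul_add, map_add, h₁, h₂]
      | tmul b t => simp

theorem lTensor_injective_of_split (A : Type v) [AddCommGroup A] [Module C A] {S T : Type*}
    [AddCommGroup S] [Module C S] [AddCommGroup T] [Module C T] (g : S →ₗ[C] T) (r : T →ₗ[C] S)
    (h : r ∘ₗ g = LinearMap.id) : Function.Injective (LinearMap.lTensor A g) := by
  apply Function.LeftInverse.injective (g := LinearMap.lTensor A r)
  intro x
  rw [← LinearMap.comp_apply, ← LinearMap.lTensor_comp, h, LinearMap.lTensor_id,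
    LinearMap.id_apply]

end Identities

/-! ### The universal property of the free supercommutative algebra -/

/-- The sign `(-1) ^ (p q)` for parities `p` and `q`. -/
def koszulSign (p q : ZMod 2) : ℤ :=
  if p = 1 ∧ q = 1 then -1 else 1

theorem koszulSign_comm (p q : ZMod 2) : koszulSign p q = koszulSign q p := by
  simp only [koszulSign, and_comm]

theorem koszulSign_zero_left (q : ZMod 2) : koszulSign 0 q = 1 := by
  simp [koszulSign]

theorem koszulSign_add_left (p p' q : ZMod 2) :
    koszulSign (p + p') q = koszulSign p q * koszulSign p' q := by
  revert p p' q
  decide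

/-- The function on the generators with values `Y i` at `y i` and `Z i` at `z i`. -/
def SuperGen.elim {B : Type w} (Y Z : ℕ → B) : SuperGen → B
  | .y i => Y i
  | .z i => Z i

section SuperLift

variable {B : Type w} [Ring B]

theorem list_prod_supercommute {F : SuperGen → B} {b : B} {q : ZMod 2}
    (h : ∀ g, F g * b = koszulSign g.parity q • (b * F g)) (l : List SuperGen) :
    (l.map F).prod * b = koszulSign (l.map SuperGen.parity).sum q • (b * (l.map F).prod) := by
  induction l with
  | nil => simp [koszulSign_zero_left]
  | cons g l ih =>
    simp only [List.map_cons, List.prod_cons, List.sum_cons]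
    rw [mul_assoc, ih, mul_smul_comm, ← mul_assoc, h, smul_mul_assoc, smul_smul, mul_assoc,
      koszulSign_add_left, mul_comm (koszulSign _ _)]

variable [Algebra C B]

/-- If the images of the generators supercommute, so do the images of homogeneous elements. -/
theorem lift_supercommute {F : SuperGen → B}
    (hF : ∀ g h, F g * F h = koszulSign g.parity h.parity • (F h * F g)) {p q : ZMod 2}
    {x x' : FreeSuper C} (hx : x ∈ FreeSuper.component C p) (hx' : x' ∈ FreeSuper.component C q) :
    FreeAlgebra.lift C F x * FreeAlgebra.lift C F x' =
      koszulSign p q • (FreeAlgebra.lift C F x' * FreeAlgebra.lift C F x) := by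
  induction hx using Submodule.span_induction with
  | zero => simp
  | add x₁ x₂ _ _ h₁ h₂ => rw [map_add, add_mul, h₁, h₂, mul_add, smul_add]
  | smul c x _ h => rw [map_smul, smul_mul_assoc, h, mul_smul_comm, smul_comm]
  | mem x hx =>
    obtain ⟨l, rfl, rfl⟩ := hx
    induction hx' using Submodule.span_induction with
    | zero => simp
    | add x₁ x₂ _ _ h₁ h₂ => rw [map_add, mul_add, h₁, h₂, add_mul, smul_add]
    | smul c x _ h => rw [map_smul, mul_smul_comm, h, smul_mul_assoc, smul_comm]
    | mem x' hx' =>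
      obtain ⟨l', rfl, rfl⟩ := hx'
      have key : ∀ l : List SuperGen,
          FreeAlgebra.lift C F (l.map (FreeAlgebra.ι C)).prod = (l.map F).prod := by
        intro l
        simp [map_list_prod, Function.comp_def]
      rw [key, key]
      apply list_prod_supercommute
      intro g
      have h' : F g * (l'.map F).prod =
          koszulSign (l'.map SuperGen.parity).sum g.parity • ((l'.map F).prod * F g) := by
        rw [list_prod_supercommute (q := g.parity) (fun k => hF k g), smul_smul]
        have hs : ∀ p q : ZMod 2, koszulSign p q * koszulSign p q = 1 := by decide
        rw [hs, one_smul]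
      rw [h', koszulSign_comm]

/-- The homomorphism from the free supercommutative algebra that takes prescribed values on the
generators, where the prescribed values supercommute. For `g = h = z i` the hypothesis says that
`2 • (F g * F g) = 0`. -/
def FreeSupercommutative.lift (F : SuperGen → B)
    (hF : ∀ g h, F g * F h = koszulSign g.parity h.parity • (F h * F g)) :
    FreeSupercommutative C →ₐ[C] B :=
  RingQuot.liftAlgHom C ⟨FreeAlgebra.lift C F, by
    rintro _ _ ⟨x₀, x₁, x₀', x₁', h₀, h₁, h₀', h₁'⟩
    simp only [map_add, map_sub, map_mul, map_zero]
    rw [lift_supercommute hF h₀ h₀', lift_supercommute hF h₁ h₀', lift_supercommute hF h₀ h₁',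
      lift_supercommute hF h₁ h₁']
    have e₀₀ : koszulSign 0 0 = 1 := by decide
    have e₁₀ : koszulSign 1 0 = 1 := by decide
    have e₀₁ : koszulSign 0 1 = 1 := by decide
    have e₁₁ : koszulSign 1 1 = -1 := by decide
    simp [e₀₀, e₁₀, e₀₁, e₁₁]⟩

end SuperLift

/-- The generators of the free supercommutative algebra. -/
def FreeSupercommutative.gen (C : Type u) [CommRing C] (g : SuperGen) : FreeSupercommutative C :=
  RingQuot.mkAlgHom C (SuperRel C) (FreeAlgebra.ι C g)

theorem FreeSupercommutative.lift_gen {B : Type w} [Ring B] [Algebra C B] (F : SuperGen → B)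
    (hF : ∀ g h, F g * F h = koszulSign g.parity h.parity • (F h * F g)) (g : SuperGen) :
    FreeSupercommutative.lift (C := C) F hF (gen C g) = F g := by
  refine (RingQuot.liftAlgHom_mkAlgHom_apply C _ _ _).trans ?_
  simp

theorem FreeSupercommutative.algHom_ext {B : Type w} [Ring B] [Algebra C B]
    {f₁ f₂ : FreeSupercommutative C →ₐ[C] B} (h : ∀ g, f₁ (gen C g) = f₂ (gen C g)) : f₁ = f₂ := by
  refine RingQuot.ringQuot_ext' C (s := SuperRel C) f₁ f₂ ?_
  apply FreeAlgebra.hom_ext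
  funext g
  exact h g

theorem FreeSupercommutative.mkAlgHom_supercommutator
    {x₀ x₁ x₀' x₁' : FreeSuper C} (h₀ : x₀ ∈ FreeSuper.component C 0)
    (h₁ : x₁ ∈ FreeSuper.component C 1) (h₀' : x₀' ∈ FreeSuper.component C 0)
    (h₁' : x₁' ∈ FreeSuper.component C 1) :
    RingQuot.mkAlgHom C (SuperRel C)
      ((x₀ * x₀' - x₀' * x₀) + (x₁ * x₀' - x₀' * x₁) + (x₀ * x₁' - x₁' * x₀)
          + (x₁ * x₁' + x₁' * x₁)) = 0 := by
  rw [RingQuot.mkAlgHom_rel C (SuperRel.supercomm x₀ x₁ x₀' x₁' h₀ h₁ h₀' h₁'), map_zero]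

theorem FreeSuper.ι_mem_component (g : SuperGen) :
    FreeAlgebra.ι C g ∈ FreeSuper.component C g.parity :=
  Submodule.subset_span ⟨[g], by simp, by simp⟩

theorem FreeSupercommutative.gen_y_mul_gen (i : ℕ) (g : SuperGen) :
    gen C (.y i) * gen C g = gen C g * gen C (.y i) := by
  have hy := FreeSuper.ι_mem_component (C := C) (.y i)
  have hg := FreeSuper.ι_mem_component (C := C) g
  rw [← sub_eq_zero]
  cases g with
  | y j =>
    have h := mkAlgHom_supercommutator hy (zero_mem _) hg (zero_mem _)
    simp only [zero_mul, mul_zero, sub_zero, add_zero, map_sub, map_mul] at h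
    exact h
  | z j =>
    have h := mkAlgHom_supercommutator hy (zero_mem _) (zero_mem _) hg
    simp only [zero_mul, mul_zero, sub_zero, add_zero, zero_add, map_sub, map_mul] at h
    exact h

theorem FreeSupercommutative.gen_z_mul_gen_z (i j : ℕ) :
    gen C (.z i) * gen C (.z j) = -(gen C (.z j) * gen C (.z i)) := by
  have hi := FreeSuper.ι_mem_component (C := C) (.z i)
  have hj := FreeSuper.ι_mem_component (C := C) (.z j)
  rw [eq_neg_iff_add_eq_zero]
  have h := mkAlgHom_supercommutator (zero_mem _) hi (zero_mem _) hj
  simp only [zero_mul, mul_zero, sub_zero, zero_add, map_add, map_mul] at h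
  exact h

/-! ### The coefficient ring -/

/-- The element `θ` of `C[ε]`. -/
def EpsRing.theta (C : Type u) [CommRing C] : EpsRing C :=
  Ideal.Quotient.mk (epsIdeal C) (MvPolynomial.X EpsGen.theta)

theorem EpsRing.theta_sq : theta C ^ 2 = 2 := by
  have h : MvPolynomial.X EpsGen.theta ^ 2 - 2 ∈ epsIdeal C :=
    Ideal.subset_span (Or.inl rfl)
  have h' := Ideal.Quotient.eq.2 h
  rw [map_pow, map_ofNat] at h'
  exact h'

theorem EpsRing.eps_sq (i : ℕ) : eps C i ^ 2 = theta C * eps C i := by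
  have h : MvPolynomial.X (EpsGen.eps i) ^ 2
      - MvPolynomial.X EpsGen.theta * MvPolynomial.X (EpsGen.eps i) ∈ epsIdeal C :=
    Ideal.subset_span (Or.inr ⟨i, rfl⟩)
  have h' := Ideal.Quotient.eq.2 h
  rw [map_pow, map_mul] at h'
  exact h'

theorem EpsRing.induction_on {p : EpsRing C → Prop} (x : EpsRing C)
    (algebraMap : ∀ c, p (algebraMap C _ c)) (theta : p (theta C)) (eps : ∀ i, p (eps C i))
    (add : ∀ x y, p x → p y → p (x + y)) (mul : ∀ x y, p x → p y → p (x * y)) : p x := by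
  obtain ⟨f, rfl⟩ := Ideal.Quotient.mk_surjective (I := epsIdeal C) x
  induction f using MvPolynomial.induction_on with
  | C c => exact algebraMap c
  | add f g hf hg => exact add _ _ hf hg
  | mul_X f i hf =>
    rw [map_mul]
    refine mul _ _ hf ?_
    cases i with
    | theta => exact theta
    | eps i => exact eps i

/-- The homomorphism from `C[ε]` to a commutative algebra that sends `θ` to `t` and `ε i` to
`s i`. -/
def EpsRing.lift {D : Type w} [CommRing D] [Algebra C D] (t : D) (s : ℕ → D) (ht : t ^ 2 = 2)
    (hs : ∀ i, s i ^ 2 = t * s i) : EpsRing C →ₐ[C] D :=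
  Ideal.Quotient.liftₐ (epsIdeal C)
    (MvPolynomial.aeval fun g : EpsGen => match g with
      | .theta => t
      | .eps i => s i) <| by
    suffices h : epsIdeal C ≤ RingHom.ker (MvPolynomial.aeval (R := C) fun g : EpsGen => match g with
      | .theta => t
      | .eps i => s i) from fun a ha => h ha
    rw [epsIdeal, Ideal.span_le]
    rintro _ (rfl | ⟨i, rfl⟩)
    · simp [RingHom.mem_ker, ht]
    · simp [RingHom.mem_ker, hs]

theorem EpsRing.lift_theta {D : Type w} [CommRing D] [Algebra C D] (t : D) (s : ℕ → D)
    (ht : t ^ 2 = 2) (hs : ∀ i, s i ^ 2 = t * s i) : lift (C := C) t s ht hs (theta C) = t :=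
  (Ideal.Quotient.liftₐ_apply _ _ _ _).trans <|
    (Ideal.Quotient.lift_mk _ _ _).trans (MvPolynomial.aeval_X _ _)

theorem EpsRing.lift_eps {D : Type w} [CommRing D] [Algebra C D] (t : D) (s : ℕ → D)
    (ht : t ^ 2 = 2) (hs : ∀ i, s i ^ 2 = t * s i) (i : ℕ) :
    lift (C := C) t s ht hs (eps C i) = s i :=
  (Ideal.Quotient.liftₐ_apply _ _ _ _).trans <|
    (Ideal.Quotient.lift_mk _ _ _).trans (MvPolynomial.aeval_X _ _)

variable (C) in
/-- The specialization of `C[ε]` in `C[√2]` at `θ = √2`, with `ε j = 0` for `j` in the first half of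
the indices and `ε j = √2` for `j` in the second half. -/
def EpsRing.specialize : EpsRing C →ₐ[C] QuadraticAlgebra C 2 0 :=
  EpsRing.lift QuadraticAlgebra.omega
    (fun j => Sum.elim (fun _ => 0) (fun _ => QuadraticAlgebra.omega)
      (Equiv.natSumNatEquivNat.symm j))
    (by ext <;> simp [sq] <;> rfl)
    (fun j => by
      rcases Equiv.natSumNatEquivNat.symm j with i | i
      · simp
      · simp [sq])

section Invertible

variable [Invertible (2 : C)]

/-- The idempotent `η i = ½ θ ε i` of `C[ε]`. -/
def EpsRing.eta (C : Type u) [CommRing C] [Invertible (2 : C)] (i : ℕ) : EpsRing C :=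
  algebraMap C _ (⅟2) * theta C * eps C i

theorem EpsRing.half_mul_two : algebraMap C (EpsRing C) (⅟2) * 2 = 1 := by
  rw [← map_ofNat (algebraMap C (EpsRing C)) 2, ← map_mul, invOf_mul_self, map_one]

theorem EpsRing.eta_mul_self (i : ℕ) : eta C i * eta C i = eta C i := by
  have h := half_mul_two (C := C)
  have ht := theta_sq (C := C)
  have he := eps_sq (C := C) i
  simp only [eta]
  set a := algebraMap C (EpsRing C) (⅟2)
  linear_combination a ^ 2 * eps C i ^ 2 * ht + 2 * a ^ 2 * he + a * theta C * eps C i * h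

theorem EpsRing.eps_mul_eps (i j : ℕ) : eps C i * eps C j = 2 * (eta C i * eta C j) := by
  have h := half_mul_two (C := C)
  have ht := theta_sq (C := C)
  simp only [eta]
  set a := algebraMap C (EpsRing C) (⅟2)
  linear_combination (-2 * a ^ 2 * eps C i * eps C j) * ht
    - (2 * a + 1) * eps C i * eps C j * h

end Invertible

/-! ### Even and odd parts of the generators of the generalized Grassmann algebra -/

/-- The generator `e i` of the generalized Grassmann algebra. -/
def GeneralizedGrassmann.e (C : Type u) [CommRing C] (i : ℕ) : GeneralizedGrassmann C :=
  RingQuot.mkAlgHom (EpsRing C) (GrassmannRel C) (FreeAlgebra.ι (EpsRing C) i)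

theorem GeneralizedGrassmann.e_comm (i j : ℕ) :
    e C i * e C j - e C j * e C i = (EpsRing.eps C i * EpsRing.eps C j) • (e C i * e C j) := by
  have h := RingQuot.mkAlgHom_rel (EpsRing C) (GrassmannRel.comm (C := C) i j)
  rw [map_sub, map_smul, map_mul, map_mul] at h
  exact h

/-- The homomorphism over `C[ε]` from the generalized Grassmann algebra that takes prescribed values
on the generators. -/
def GeneralizedGrassmann.lift {B : Type w} [Ring B] [Algebra (EpsRing C) B] (b : ℕ → B)
    (hb : ∀ i j, b i * b j - b j * b i = (EpsRing.eps C i * EpsRing.eps C j) • (b i * b j)) :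
    GeneralizedGrassmann C →ₐ[EpsRing C] B :=
  RingQuot.liftAlgHom (EpsRing C) ⟨FreeAlgebra.lift (EpsRing C) b, by
    rintro _ _ ⟨i, j⟩
    simp only [map_sub, map_mul, map_smul, FreeAlgebra.lift_ι_apply]
    exact hb i j⟩

theorem GeneralizedGrassmann.lift_e {B : Type w} [Ring B] [Algebra (EpsRing C) B] (b : ℕ → B)
    (hb : ∀ i j, b i * b j - b j * b i = (EpsRing.eps C i * EpsRing.eps C j) • (b i * b j))
    (i : ℕ) : lift (C := C) b hb (e C i) = b i := by
  refine (RingQuot.liftAlgHom_mkAlgHom_apply (EpsRing C) _ _ _).trans ?_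
  simp

theorem GeneralizedGrassmann.induction_on {p : GeneralizedGrassmann C → Prop}
    (x : GeneralizedGrassmann C) (algebraMap : ∀ r, p (algebraMap (EpsRing C) _ r))
    (e : ∀ i, p (e C i)) (add : ∀ x y, p x → p y → p (x + y))
    (mul : ∀ x y, p x → p y → p (x * y)) : p x := by
  obtain ⟨f, rfl⟩ := RingQuot.mkAlgHom_surjective (EpsRing C) (GrassmannRel C) x
  induction f using FreeAlgebra.induction with
  | grade0 r =>
    rw [AlgHom.commutes]
    exact algebraMap r
  | grade1 i => exact e i
  | mul f g hf hg =>
    rw [map_mul]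
    exact mul _ _ hf hg
  | add f g hf hg =>
    rw [map_add]
    exact add _ _ hf hg

section Parts

variable [Invertible (2 : C)]

open EpsRing GeneralizedGrassmann

theorem GeneralizedGrassmann.e_mul_e (i j : ℕ) :
    e C j * e C i = (1 - 2 * (eta C i * eta C j)) • (e C i * e C j) := by
  rw [sub_smul, one_smul, ← eps_mul_eps, ← e_comm, sub_sub_cancel]

/-- The even part `(1 - η i) e i` of the generator `e i`. -/
def GeneralizedGrassmann.even (C : Type u) [CommRing C] [Invertible (2 : C)] (i : ℕ) :
    GeneralizedGrassmann C :=
  (1 - eta C i) • e C i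

/-- The odd part `η i e i` of the generator `e i`. -/
def GeneralizedGrassmann.odd (C : Type u) [CommRing C] [Invertible (2 : C)] (i : ℕ) :
    GeneralizedGrassmann C :=
  eta C i • e C i

theorem GeneralizedGrassmann.even_add_odd (i : ℕ) : even C i + odd C i = e C i := by
  rw [even, odd, ← add_smul, sub_add_cancel, one_smul]

theorem GeneralizedGrassmann.even_mul_e (i j : ℕ) :
    even C i * e C j = e C j * even C i := by
  have h := eta_mul_self (C := C) i
  rw [even, smul_mul_assoc, mul_smul_comm, e_mul_e i j, smul_smul]
  congr 1
  linear_combination -2 * eta C j * h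

theorem GeneralizedGrassmann.odd_mul_odd (i j : ℕ) :
    odd C i * odd C j = -(odd C j * odd C i) := by
  have hi := eta_mul_self (C := C) i
  have hj := eta_mul_self (C := C) j
  rw [odd, odd, smul_mul_smul_comm, smul_mul_smul_comm, e_mul_e i j, smul_smul, ← neg_smul]
  congr 1
  linear_combination (-2 * eta C j ^ 2) * hi - 2 * eta C i * hj

/-- Central elements `Y i` of the generalized Grassmann algebra and odd parts of generators
supercommute. -/
theorem GeneralizedGrassmann.supercommute {Y : ℕ → GeneralizedGrassmann C}
    (hY : ∀ i x, Y i * x = x * Y i) (k : ℕ → ℕ) (g h : SuperGen) :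
    g.elim Y (fun i => odd C (k i)) * h.elim Y (fun i => odd C (k i)) =
      koszulSign g.parity h.parity •
        (h.elim Y (fun i => odd C (k i)) * g.elim Y (fun i => odd C (k i))) := by
  cases g <;> cases h
  · rw [show koszulSign (SuperGen.parity (.y _)) (SuperGen.parity (.y _)) = 1 from rfl, one_smul]
    exact hY _ _
  · rw [show koszulSign (SuperGen.parity (.y _)) (SuperGen.parity (.z _)) = 1 from rfl, one_smul]
    exact hY _ _
  · rw [show koszulSign (SuperGen.parity (.z _)) (SuperGen.parity (.y _)) = 1 from rfl, one_smul]
    exact (hY _ _).symm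
  · rw [show koszulSign (SuperGen.parity (.z _)) (SuperGen.parity (.z _)) = -1 from rfl, neg_smul,
      one_smul]
    exact odd_mul_odd _ _

theorem GeneralizedGrassmann.even_mul (i : ℕ) (x : GeneralizedGrassmann C) :
    even C i * x = x * even C i := by
  induction x using GeneralizedGrassmann.induction_on with
  | algebraMap r => exact (Algebra.commutes r _).symm
  | e j => exact even_mul_e i j
  | add x y hx hy => rw [mul_add, add_mul, hx, hy]
  | mul x y hx hy => rw [← mul_assoc, hx, mul_assoc, hy, mul_assoc]

/-! ### The two homomorphisms -/

variable (C) in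
/-- The generalized Grassmann algebra is a quotient of the free supercommutative algebra. -/
theorem exists_surjective_algHom :
    ∃ f : FreeSupercommutative C →ₐ[C] GeneralizedGrassmann C, Function.Surjective f := by
  -- The even generators are split into two infinite families: one covers the even parts of the
  -- `e i`, the other one covers `θ` and the `ε i`.
  let G : ℕ ⊕ ℕ → GeneralizedGrassmann C := fun s => match s with
    | .inl i => even C i
    | .inr 0 => algebraMap (EpsRing C) _ (theta C)
    | .inr (i + 1) => algebraMap (EpsRing C) _ (eps C i)
  have hG : ∀ s x, G s * x = x * G s := by
    rintro (i | _ | i) x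
    · exact even_mul i x
    · exact Algebra.commutes _ x
    · exact Algebra.commutes _ x
  have hF := supercommute (C := C) (Y := fun i => G (Equiv.natSumNatEquivNat.symm i))
    (fun i x => hG _ x) id
  let f := FreeSupercommutative.lift (C := C) _ hF
  have hy : ∀ s, G s ∈ f.range := fun s =>
    ⟨.gen C (.y (Equiv.natSumNatEquivNat s)), by
      refine (FreeSupercommutative.lift_gen _ hF _).trans ?_
      exact congrArg G (Equiv.symm_apply_apply _ s)⟩
  have hz : ∀ i, odd C i ∈ f.range := fun i =>
    ⟨.gen C (.z i), FreeSupercommutative.lift_gen _ hF _⟩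
  refine ⟨f, fun x => ?_⟩
  change x ∈ f.range
  induction x using GeneralizedGrassmann.induction_on with
  | algebraMap r =>
    induction r using EpsRing.induction_on with
    | algebraMap c =>
      rw [← IsScalarTower.algebraMap_apply]
      exact f.range.algebraMap_mem c
    | theta => exact hy (.inr 0)
    | eps i => exact hy (.inr (i + 1))
    | add x y hx hy =>
      rw [map_add]
      exact add_mem hx hy
    | mul x y hx hy =>
      rw [map_mul]
      exact mul_mem hx hy
  | e i =>
    rw [← even_add_odd]
    exact add_mem (hy (.inl i)) (hz i)
  | add x y hx hy => exact add_mem hx hy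
  | mul x y hx hy => exact mul_mem hx hy

theorem EpsRing.specialize_eta_inl (i : ℕ) :
    specialize C (eta C (Equiv.natSumNatEquivNat (.inl i))) = 0 := by
  rw [eta, map_mul, specialize, lift_eps]
  simp

theorem EpsRing.specialize_eta_inr (i : ℕ) :
    specialize C (eta C (Equiv.natSumNatEquivNat (.inr i))) = 1 := by
  rw [eta, map_mul, map_mul, AlgHom.commutes, specialize, lift_eps, lift_theta]
  ext <;> simp <;> rfl

variable (C) in
/-- There is a homomorphism over `C[ε]`, with `C[ε]` acting through `EpsRing.specialize`, from the
generalized Grassmann algebra to `C[√2] ⊗ S` that sends the `e j` with `j` in the first half of the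
indices to the even generators of `S`, and the others to the odd generators. -/
theorem exists_specialization :
    ∃ f : GeneralizedGrassmann C →ₐ[C] QuadraticAlgebra C 2 0 ⊗[C] FreeSupercommutative C,
      (∀ i, f (even C (Equiv.natSumNatEquivNat (.inl i))) = 1 ⊗ₜ .gen C (.y i)) ∧
      (∀ i, f (odd C (Equiv.natSumNatEquivNat (.inr i))) = 1 ⊗ₜ .gen C (.z i)) := by
  let : Algebra (EpsRing C) (QuadraticAlgebra C 2 0 ⊗[C] FreeSupercommutative C) :=
    Algebra.compHom _ (specialize C).toRingHom
  have hsmul (r : EpsRing C) (x : QuadraticAlgebra C 2 0 ⊗[C] FreeSupercommutative C) :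
      r • x = specialize C r • x := rfl
  have : IsScalarTower C (EpsRing C) (QuadraticAlgebra C 2 0 ⊗[C] FreeSupercommutative C) :=
    ⟨fun c r x => by rw [hsmul, hsmul, map_smul, smul_assoc]⟩
  let b : ℕ ⊕ ℕ → QuadraticAlgebra C 2 0 ⊗[C] FreeSupercommutative C :=
    fun s => 1 ⊗ₜ .gen C (Sum.elim SuperGen.y SuperGen.z s)
  have hb : ∀ i j, b (Equiv.natSumNatEquivNat.symm i) * b (Equiv.natSumNatEquivNat.symm j) -
      b (Equiv.natSumNatEquivNat.symm j) * b (Equiv.natSumNatEquivNat.symm i) =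
      (eps C i * eps C j) •
        (b (Equiv.natSumNatEquivNat.symm i) * b (Equiv.natSumNatEquivNat.symm j)) := by
    intro i j
    obtain ⟨s, rfl⟩ := Equiv.natSumNatEquivNat.surjective i
    obtain ⟨t, rfl⟩ := Equiv.natSumNatEquivNat.surjective j
    rw [hsmul, eps_mul_eps, map_mul, map_mul]
    simp only [Equiv.symm_apply_apply, b, Algebra.TensorProduct.tmul_mul_tmul, mul_one]
    rcases s with i | i
    · rw [specialize_eta_inl]
      simp [FreeSupercommutative.gen_y_mul_gen]
    rcases t with j | j
    · rw [specialize_eta_inl]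
      simp [FreeSupercommutative.gen_y_mul_gen]
    · rw [specialize_eta_inr, specialize_eta_inr]
      simp only [Sum.elim_inr, map_ofNat, mul_one]
      rw [FreeSupercommutative.gen_z_mul_gen_z j i, TensorProduct.tmul_neg, sub_neg_eq_add,
        ofNat_smul_eq_nsmul, two_nsmul]
  refine ⟨(GeneralizedGrassmann.lift _ hb).restrictScalars C, fun i => ?_, fun i => ?_⟩
  · rw [AlgHom.restrictScalars_apply, even, map_smul, lift_e, hsmul, map_sub, map_one,
      specialize_eta_inl, sub_zero, one_smul, Equiv.symm_apply_apply]
    rfl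
  · rw [AlgHom.restrictScalars_apply, odd, map_smul, lift_e, hsmul, specialize_eta_inr, one_smul,
      Equiv.symm_apply_apply]
    rfl

variable (C) in
/-- The free supercommutative algebra embeds in the generalized Grassmann algebra as a direct summand
over `C`. -/
theorem exists_algHom_split :
    ∃ (f : FreeSupercommutative C →ₐ[C] GeneralizedGrassmann C)
      (r : GeneralizedGrassmann C →ₗ[C] FreeSupercommutative C),
      r ∘ₗ f.toLinearMap = LinearMap.id := by
  have hF := supercommute (C := C) (Y := fun i => even C (Equiv.natSumNatEquivNat (.inl i)))
    (fun i x => even_mul _ x) (fun i => Equiv.natSumNatEquivNat (.inr i))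
  obtain ⟨g, hy, hz⟩ := exists_specialization C
  let f := FreeSupercommutative.lift (C := C) _ hF
  have hgf : g.comp f = Algebra.TensorProduct.includeRight := by
    apply FreeSupercommutative.algHom_ext
    intro k
    rw [AlgHom.comp_apply, FreeSupercommutative.lift_gen]
    cases k with
    | y i => exact hy i
    | z i => exact hz i
  -- The retraction is the specialization followed by the projection of `C[√2] = C ⊕ C√2` to `C`.
  let p : QuadraticAlgebra C 2 0 ⊗[C] FreeSupercommutative C →ₗ[C] FreeSupercommutative C :=
    (TensorProduct.lid C _).toLinearMap ∘ₗ
      LinearMap.rTensor _ (QuadraticAlgebra.reₗ 2 0)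
  refine ⟨f, p ∘ₗ g.toLinearMap, LinearMap.ext fun x => ?_⟩
  have hx : g (f x) = 1 ⊗ₜ x := DFunLike.congr_fun hgf x
  have h1 : QuadraticAlgebra.re (1 : QuadraticAlgebra C 2 0) = 1 := rfl
  simp [hx, p, h1]

end Parts

end GenGrassmann

end

theorem mainTheorem2 (C : Type u) [CommRing C] (h2 : IsUnit (2 : C)) :
    (∀ (A : Type v) [NonUnitalRing A] [Module C A] [IsScalarTower C A A] [SMulCommClass C A A],
      GenGrassmann.idNonUnital C (A ⊗[C] GenGrassmann.FreeSupercommutative C) =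
        GenGrassmann.idNonUnital C (A ⊗[C] GenGrassmann.GeneralizedGrassmann C)) ∧
    (∀ (A : Type v) [Ring A] [Algebra C A],
      GenGrassmann.idUnital C (A ⊗[C] GenGrassmann.FreeSupercommutative C) =
        GenGrassmann.idUnital C (A ⊗[C] GenGrassmann.GeneralizedGrassmann C)) ∧
    (∀ n : ℕ,
      GenGrassmann.idUnital C (Matrix (Fin n) (Fin n) (GenGrassmann.FreeSupercommutative C)) =
        GenGrassmann.idUnital C
          (Matrix (Fin n) (Fin n) (GenGrassmann.GeneralizedGrassmann C))) := by
  let := h2.invertible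
  obtain ⟨f, hf⟩ := GenGrassmann.exists_surjective_algHom C
  obtain ⟨g, r, hr⟩ := GenGrassmann.exists_algHom_split C
  have hg : Function.Injective g :=
    Function.LeftInverse.injective (g := r) fun x => DFunLike.congr_fun hr x
  refine ⟨fun A _ _ _ _ => ?_, fun A _ _ => ?_, fun n => ?_⟩
  · refine Set.Subset.antisymm
      (GenGrassmann.idNonUnital_subset_of_surjective (GenGrassmann.lTensorNonUnital A f) ?_)
      (GenGrassmann.idNonUnital_subset_of_injective (GenGrassmann.lTensorNonUnital A g) ?_)
    · exact LinearMap.lTensor_surjective A hf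
    · exact GenGrassmann.lTensor_injective_of_split A _ r hr
  · refine Set.Subset.antisymm
      (GenGrassmann.idUnital_subset_of_surjective
        (Algebra.TensorProduct.map (AlgHom.id C A) f) ?_)
      (GenGrassmann.idUnital_subset_of_injective
        (Algebra.TensorProduct.map (AlgHom.id C A) g) ?_)
    · exact LinearMap.lTensor_surjective A hf
    · exact GenGrassmann.lTensor_injective_of_split A _ r hr
  · refine Set.Subset.antisymm
      (GenGrassmann.idUnital_subset_of_surjective f.mapMatrix fun M => ?_)
      (GenGrassmann.idUnital_subset_of_injective g.mapMatrix fun M N h => ?_)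
    · choose N hN using fun i j => hf (M i j)
      exact ⟨Matrix.of N, Matrix.ext hN⟩
    · exact Matrix.ext fun i j => hg (congrFun (congrFun h i) j)
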